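/- For $0\le k<1$ let $$\mathbf K(k)=\int_0^1\frac{dx}{\sqrt{(1-x^2)(1-k^2x^2)}}$$ denote the complete elliptic integral of the first kind with modulus $k$. (i) For all real numbers $a,b$ with $0<b<a$, the following integral converges absolutely and $$\int_0^b\frac{\ln x\,dx}{\sqrt{(a^2-x^2)(b^2-x^2)}}=\frac1{2a}\left[\mathbf K\!\left(\frac ba\right)\ln(ab)-\frac{\pi}{2}\,\mathbf K\!\left(\frac{\sqrt{a^2-b^2}}{a}\right)\right].$$ (ii) Equivalently, for every real $c$ with $0<c<1$, the following integral converges absolutely and $$\int_0^1\frac{\ln x\,dx}{\sqrt{(1-x^2)(1-c^2x^2)}}=-\frac{\pi}{4}\,\mathbf K\!\left(\sqrt{1-c^2}\right)-\frac12\,\mathbf K(c)\,\ln c.$$ -/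

import Mathlib

/-- The complete elliptic integral of the first kind, as a function of the modulus `k`
(used for `0 ≤ k < 1`, where the integral converges). -/
noncomputable def ellipticK (k : ℝ) : ℝ :=
  ∫ x in (0 : ℝ)..1, 1 / Real.sqrt ((1 - x ^ 2) * (1 - k ^ 2 * x ^ 2))

/-- The integrand of `I(a,b)`. -/
noncomputable def integrandI (a b x : ℝ) : ℝ :=
  Real.log x / Real.sqrt ((a ^ 2 - x ^ 2) * (b ^ 2 - x ^ 2))

/-- The integrand of `J(c)`. -/
noncomputable def integrandJ (c x : ℝ) : ℝ :=
  Real.log x / Real.sqrt ((1 - x ^ 2) * (1 - c ^ 2 * x ^ 2))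

open MeasureTheory Set Filter Topology

/-! Part (ii) is Fubini on the unit square for the nonnegative kernel `logEllipticKernel c x z`.
Integrated in `z` it gives logarithms, namely `-(2 log x + log c)` times the integrand of `K(c)`;
integrated in `x` it gives an arctangent, namely `π/2` times the integrand of `K(√(1 - c²))`.
Equating the two iterated integrals and solving for the `log x` term yields (ii). Part (i) follows
by `x = b t` with `c = b / a`.

Both inner integrals have explicit antiderivatives; positivity makes integrability follow from their
finite endpoint limits. -/

theorem integrableOn_and_integral_Ioo_of_hasDerivAt_of_nonneg {f f' : ℝ → ℝ} {a b m M : ℝ}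
    (hab : a < b) (hf : ∀ x ∈ Ioo a b, HasDerivAt f (f' x) x) (hpos : ∀ x ∈ Ioo a b, 0 ≤ f' x)
    (ha : Tendsto f (𝓝[>] a) (𝓝 m)) (hb : Tendsto f (𝓝[<] b) (𝓝 M)) :
    IntegrableOn f' (Ioo a b) ∧ ∫ x in Ioo a b, f' x = M - m := by
  have hcont : ContinuousOn (extendFrom (Ioo a b) f) (Icc a b) :=
    continuousOn_Icc_extendFrom_Ioo
      (fun x hx => (hf x hx).continuousAt.continuousWithinAt) ha hb
  have hderiv : ∀ x ∈ Ioo a b, HasDerivAt (extendFrom (Ioo a b) f) (f' x) x := by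
    intro x hx
    refine (hf x hx).congr_of_eventuallyEq ?_
    filter_upwards [isOpen_Ioo.mem_nhds hx] with y hy
    exact extendFrom_eq (subset_closure hy) (hf y hy).continuousAt.continuousWithinAt
  have hint := intervalIntegral.integrableOn_deriv_of_nonneg hcont hderiv hpos
  refine ⟨hint.mono_set Ioo_subset_Ioc_self, ?_⟩
  rw [← integral_Ioc_eq_integral_Ioo, ← intervalIntegral.integral_of_le hab.le]
  exact intervalIntegral.integral_eq_sub_of_hasDerivAt_of_tendsto hab hf
    ((intervalIntegrable_iff_integrableOn_Ioc_of_le hab.le).2 hint) ha hb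

/-- The kernel whose two iterated integrals over the unit square give the two sides of the
logarithmic elliptic integral formula. -/
noncomputable def logEllipticKernel (c x z : ℝ) : ℝ :=
  z * (1 - c ^ 2 * x ^ 4) / ((x ^ 2 + (1 - x ^ 2) * z ^ 2) * (1 - (1 - c ^ 2 * x ^ 2) * z ^ 2) *
    Real.sqrt ((1 - x ^ 2) * (1 - c ^ 2 * x ^ 2)))

theorem sq_mem_Ioo_zero_one {x : ℝ} (hx : x ∈ Ioo (0 : ℝ) 1) : x ^ 2 ∈ Ioo (0 : ℝ) 1 :=
  ⟨pow_pos hx.1 2, pow_lt_one₀ hx.1.le hx.2 two_ne_zero⟩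

theorem one_sub_mul_pos_of_mem_Ioo {s t : ℝ} (hs : s ∈ Ioo (0 : ℝ) 1) (ht : t ∈ Ioo (0 : ℝ) 1) :
    0 < 1 - s * t := by
  nlinarith [hs.1, hs.2, ht.1, ht.2]

theorem logEllipticKernel_nonneg {c x z : ℝ} (hc : c ∈ Ioo (0 : ℝ) 1) (hx : x ∈ Ioo (0 : ℝ) 1)
    (hz : z ∈ Ioo (0 : ℝ) 1) : 0 ≤ logEllipticKernel c x z := by
  have hc2 := sq_mem_Ioo_zero_one hc
  have hx2 := sq_mem_Ioo_zero_one hx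
  have hz2 := sq_mem_Ioo_zero_one hz
  have hx4 := sq_mem_Ioo_zero_one hx2
  have h1 := one_sub_mul_pos_of_mem_Ioo hc2 hx2
  have h2 := one_sub_mul_pos_of_mem_Ioo hc2 hx4
  have h3 : 1 - c ^ 2 * x ^ 2 ∈ Ioo (0 : ℝ) 1 := ⟨h1, by nlinarith [mul_pos hc2.1 hx2.1]⟩
  have h4 := one_sub_mul_pos_of_mem_Ioo h3 hz2
  have h5 : 0 < 1 - x ^ 2 := sub_pos.2 hx2.2
  have h6 : 0 ≤ 1 - c ^ 2 * x ^ 4 := by nlinarith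
  have := hx2.1
  have := hz2.1
  have := hz.1
  unfold logEllipticKernel
  positivity

/-- Partial fractions in `z²`: the numerator is what remains when the logarithmic derivatives of the
two quadratic factors are subtracted. -/
theorem integral_logEllipticKernel_right {c x : ℝ} (hc : c ∈ Ioo (0 : ℝ) 1)
    (hx : x ∈ Ioo (0 : ℝ) 1) :
    ∫ z in Ioo (0 : ℝ) 1, logEllipticKernel c x z =
      -(2 * Real.log x + Real.log c) / Real.sqrt ((1 - x ^ 2) * (1 - c ^ 2 * x ^ 2)) := by
  have hc2 := sq_mem_Ioo_zero_one hc
  have hx2 := sq_mem_Ioo_zero_one hx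
  have h1 := one_sub_mul_pos_of_mem_Ioo hc2 hx2
  have h3 : 1 - c ^ 2 * x ^ 2 ∈ Ioo (0 : ℝ) 1 := ⟨h1, by nlinarith [mul_pos hc2.1 hx2.1]⟩
  have h5 : 0 < 1 - x ^ 2 := sub_pos.2 hx2.2
  set S := Real.sqrt ((1 - x ^ 2) * (1 - c ^ 2 * x ^ 2)) with hS
  have hSpos : 0 < S := Real.sqrt_pos.2 (mul_pos h5 h1)
  have hA : ∀ z : ℝ, x ^ 2 + (1 - x ^ 2) * z ^ 2 ≠ 0 := fun z => by
    have := hx2.1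
    positivity
  have hB : ∀ z ∈ Icc (0 : ℝ) 1, 1 - (1 - c ^ 2 * x ^ 2) * z ^ 2 ≠ 0 := fun z hz => by
    have : z ^ 2 ≤ 1 := pow_le_one₀ hz.1 hz.2
    have h := h3.2
    have := sq_nonneg z
    nlinarith
  let f : ℝ → ℝ := fun z => (Real.log (x ^ 2 + (1 - x ^ 2) * z ^ 2) -
    Real.log (1 - (1 - c ^ 2 * x ^ 2) * z ^ 2)) / (2 * S)
  have hf : ∀ z ∈ Icc (0 : ℝ) 1, HasDerivAt f (logEllipticKernel c x z) z := by
    intro z hz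
    have hd1 : HasDerivAt (fun z : ℝ => x ^ 2 + (1 - x ^ 2) * z ^ 2) ((1 - x ^ 2) * (2 * z)) z := by
      simpa using ((hasDerivAt_pow 2 z).const_mul (1 - x ^ 2)).const_add (x ^ 2)
    have hd2 : HasDerivAt (fun z : ℝ => 1 - (1 - c ^ 2 * x ^ 2) * z ^ 2)
        (-((1 - c ^ 2 * x ^ 2) * (2 * z))) z := by
      simpa using ((hasDerivAt_pow 2 z).const_mul (1 - c ^ 2 * x ^ 2)).const_sub 1
    refine (((hd1.log (hA z)).sub (hd2.log (hB z hz))).div_const (2 * S)).congr_deriv ?_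
    have hA' := hA z
    have hB' := hB z hz
    unfold logEllipticKernel
    rw [← hS, div_sub_div _ _ hA' hB', div_div, div_eq_div_iff
      (mul_ne_zero (mul_ne_zero hA' hB') (by positivity)) (mul_ne_zero (mul_ne_zero hA' hB') hSpos.ne')]
    ring
  have h := (integrableOn_and_integral_Ioo_of_hasDerivAt_of_nonneg zero_lt_one
    (fun z hz => hf z (Ioo_subset_Icc_self hz))
    (fun z hz => logEllipticKernel_nonneg hc hx hz)
    (hf 0 ⟨le_rfl, zero_le_one⟩).continuousAt.continuousWithinAt
    (hf 1 ⟨zero_le_one, le_rfl⟩).continuousAt.continuousWithinAt).2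
  rw [h]
  have e : (1 : ℝ) - (1 - c ^ 2 * x ^ 2) * 1 ^ 2 = (c * x) ^ 2 := by ring
  simp only [f]
  rw [e, Real.log_pow, Real.log_mul hc.1.ne' hx.1.ne']
  simp only [one_pow, mul_one, add_sub_cancel, Real.log_one, ne_eq, OfNat.ofNat_ne_zero,
    not_false_eq_true, zero_pow, mul_zero, add_zero, sub_zero, Real.log_pow]
  push_cast
  field_simp
  ring

/-- In the variable `y = √((1 - x²)(1 - c²x²)) / x`, which runs from `∞` down to `0`, the kernel
becomes an arctangent derivative. -/
theorem integral_logEllipticKernel_left {c z : ℝ} (hc : c ∈ Ioo (0 : ℝ) 1)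
    (hz : z ∈ Ioo (0 : ℝ) 1) :
    IntegrableOn (fun x => logEllipticKernel c x z) (Ioo 0 1) ∧
      ∫ x in Ioo (0 : ℝ) 1, logEllipticKernel c x z =
        Real.pi / 2 * (1 / Real.sqrt ((1 - z ^ 2) * (1 - (1 - c ^ 2) * z ^ 2))) := by
  have hc2 := sq_mem_Ioo_zero_one hc
  have hz2 := sq_mem_Ioo_zero_one hz
  have hβ : 0 < 1 - (1 - c ^ 2) * z ^ 2 :=
    one_sub_mul_pos_of_mem_Ioo ⟨sub_pos.2 hc2.2, by linarith [hc2.1]⟩ hz2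
  have hγ : 0 < 1 - z ^ 2 := sub_pos.2 hz2.2
  rw [Real.sqrt_mul hγ.le]
  set b := Real.sqrt (1 - (1 - c ^ 2) * z ^ 2) with hb
  set g := Real.sqrt (1 - z ^ 2) with hg
  have hb0 : 0 < b := Real.sqrt_pos.2 hβ
  have hg0 : 0 < g := Real.sqrt_pos.2 hγ
  have hbb : b ^ 2 = 1 - (1 - c ^ 2) * z ^ 2 := Real.sq_sqrt hβ.le
  have hgg : g ^ 2 = 1 - z ^ 2 := Real.sq_sqrt hγ.le
  have hz0 := hz.1
  let y : ℝ → ℝ := fun x => Real.sqrt ((1 - x ^ 2) * (1 - c ^ 2 * x ^ 2)) / x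
  let f : ℝ → ℝ := fun x => -(1 / (g * b)) * Real.arctan (z * g / b * y x)
  have hf : ∀ x ∈ Ioo (0 : ℝ) 1, HasDerivAt f (logEllipticKernel c x z) x := by
    intro x hx
    have hx0 := hx.1
    have hx2 := sq_mem_Ioo_zero_one hx
    have h1 := one_sub_mul_pos_of_mem_Ioo hc2 hx2
    have h3 : 1 - c ^ 2 * x ^ 2 ∈ Ioo (0 : ℝ) 1 := ⟨h1, by nlinarith [mul_pos hc2.1 hx2.1]⟩
    have hB := one_sub_mul_pos_of_mem_Ioo h3 hz2
    have h5 : 0 < 1 - x ^ 2 := sub_pos.2 hx2.2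
    have hA : 0 < x ^ 2 + (1 - x ^ 2) * z ^ 2 := by have := hx2.1; positivity
    have hp := mul_pos h5 h1
    have hd1 : HasDerivAt (fun x : ℝ => (1 - x ^ 2) * (1 - c ^ 2 * x ^ 2))
        (-(2 * x) * (1 - c ^ 2 * x ^ 2) + (1 - x ^ 2) * -(c ^ 2 * (2 * x))) x := by
      refine HasDerivAt.mul ?_ ?_
      · simpa using (hasDerivAt_pow 2 x).const_sub 1
      · simpa using ((hasDerivAt_pow 2 x).const_mul (c ^ 2)).const_sub 1
    have hd2 := (((hd1.sqrt hp.ne').div (hasDerivAt_id x) hx0.ne').const_mul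
      (z * g / b)).arctan.const_mul (-(1 / (g * b)))
    refine hd2.congr_deriv ?_
    simp only [logEllipticKernel, Pi.div_apply, id]
    set S := Real.sqrt ((1 - x ^ 2) * (1 - c ^ 2 * x ^ 2)) with hS
    have hS0 : 0 < S := Real.sqrt_pos.2 hp
    have hSS : S ^ 2 = (1 - x ^ 2) * (1 - c ^ 2 * x ^ 2) := Real.sq_sqrt hp.le
    -- The product of the two quadratics is a sum of two squares, which is the arctangent
    -- denominator.
    have key : (x ^ 2 + (1 - x ^ 2) * z ^ 2) * (1 - (1 - c ^ 2 * x ^ 2) * z ^ 2) =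
        b ^ 2 * x ^ 2 + z ^ 2 * g ^ 2 * S ^ 2 := by
      rw [hbb, hgg, hSS]; ring
    have key2 : (-(2 * x) * (1 - c ^ 2 * x ^ 2) + (1 - x ^ 2) * -(c ^ 2 * (2 * x))) / (2 * S) * x
        - S * 1 = -(1 - c ^ 2 * x ^ 4) / S := by
      field_simp
      rw [hSS]
      ring
    have hne : b ^ 2 * x ^ 2 + z ^ 2 * g ^ 2 * S ^ 2 ≠ 0 := by positivity
    rw [key, key2]
    have hden : 1 + (z * g / b * (S / x)) ^ 2 =
        (b ^ 2 * x ^ 2 + z ^ 2 * g ^ 2 * S ^ 2) / (b ^ 2 * x ^ 2) := by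
      field_simp
    rw [hden]
    field_simp
  have h0 : Tendsto f (𝓝[>] 0) (𝓝 (-(1 / (g * b)) * (Real.pi / 2))) := by
    refine Tendsto.const_mul _ ((Real.tendsto_arctan_atTop.mono_right nhdsWithin_le_nhds).comp ?_)
    refine Tendsto.const_mul_atTop (by positivity) ?_
    have hc0 : Tendsto (fun x : ℝ => Real.sqrt ((1 - x ^ 2) * (1 - c ^ 2 * x ^ 2))) (𝓝[>] 0)
        (𝓝 1) := by
      have : Continuous fun x : ℝ => Real.sqrt ((1 - x ^ 2) * (1 - c ^ 2 * x ^ 2)) := by fun_prop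
      simpa using (this.tendsto 0).mono_left nhdsWithin_le_nhds
    simpa only [y, div_eq_mul_inv] using hc0.pos_mul_atTop one_pos tendsto_inv_nhdsGT_zero
  have h1 : Tendsto f (𝓝[<] 1) (𝓝 0) := by
    have : ContinuousAt f 1 := by
      have : ContinuousAt y 1 := ContinuousAt.div (by fun_prop) continuousAt_id one_ne_zero
      exact (Real.continuous_arctan.continuousAt.comp (this.const_mul _)).const_mul _
    have h := this.tendsto.mono_left (nhdsWithin_le_nhds (s := Iio 1))
    simpa [f, y] using h
  obtain ⟨hi, he⟩ := integrableOn_and_integral_Ioo_of_hasDerivAt_of_nonneg zero_lt_one hf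
    (fun x hx => logEllipticKernel_nonneg hc hx hz) h0 h1
  exact ⟨hi, by rw [he]; ring⟩

/-- The singularity at `1` is that of the derivative of `arcsin`; the other factor is continuous on
`[0, 1]`. -/
theorem integrableOn_ellipticK_integrand {k : ℝ} (hk : k ∈ Ioo (0 : ℝ) 1) :
    IntegrableOn (fun x : ℝ => 1 / Real.sqrt ((1 - x ^ 2) * (1 - k ^ 2 * x ^ 2))) (Ioo 0 1) := by
  have hk2 := sq_mem_Ioo_zero_one hk
  have h : IntegrableOn (fun x : ℝ => 1 / Real.sqrt (1 - x ^ 2)) (Ioo 0 1) :=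
    (integrableOn_and_integral_Ioo_of_hasDerivAt_of_nonneg zero_lt_one
      (fun x hx => Real.hasDerivAt_arcsin (by linarith [hx.1]) hx.2.ne)
      (fun x _ => by positivity)
      Real.continuous_arcsin.continuousAt.continuousWithinAt
      Real.continuous_arcsin.continuousAt.continuousWithinAt).1
  have hpos : ∀ x ∈ Icc (0 : ℝ) 1, 0 < 1 - k ^ 2 * x ^ 2 := fun x hx => by
    have : x ^ 2 ≤ 1 := pow_le_one₀ hx.1 hx.2
    nlinarith [hk2.1, hk2.2]
  have h' := ((integrableOn_Icc_iff_integrableOn_Ioo).2 h).mul_continuousOn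
    (g' := fun x : ℝ => 1 / Real.sqrt (1 - k ^ 2 * x ^ 2))
    (ContinuousOn.div (by fun_prop) (by fun_prop) fun x hx => (Real.sqrt_pos.2 (hpos x hx)).ne')
    isCompact_Icc
  refine (h'.mono_set Ioo_subset_Icc_self).congr_fun (fun x hx => ?_) measurableSet_Ioo
  have := sq_mem_Ioo_zero_one hx
  rw [Real.sqrt_mul (by linarith [this.2])]
  exact one_div_mul_one_div _ _

theorem ellipticK_eq_integral_Ioo (k : ℝ) : ellipticK k =
    ∫ x in Ioo (0 : ℝ) 1, 1 / Real.sqrt ((1 - x ^ 2) * (1 - k ^ 2 * x ^ 2)) := by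
  rw [ellipticK, intervalIntegral.integral_of_le zero_le_one, integral_Ioc_eq_integral_Ioo]

theorem sqrt_one_sub_sq_mem_Ioo {c : ℝ} (hc : c ∈ Ioo (0 : ℝ) 1) :
    Real.sqrt (1 - c ^ 2) ∈ Ioo (0 : ℝ) 1 := by
  have hc2 := sq_mem_Ioo_zero_one hc
  exact ⟨Real.sqrt_pos.2 (sub_pos.2 hc2.2), by
    rw [Real.sqrt_lt' one_pos]; linarith [hc2.1]⟩

/-- Tonelli, taking the `x`-integral first: by positivity the norm integrates to a multiple of an
elliptic integrand. -/
theorem integrable_logEllipticKernel {c : ℝ} (hc : c ∈ Ioo (0 : ℝ) 1) :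
    Integrable (Function.uncurry (logEllipticKernel c))
      ((volume.restrict (Ioo (0 : ℝ) 1)).prod (volume.restrict (Ioo (0 : ℝ) 1))) := by
  have hmeas : Measurable (Function.uncurry (logEllipticKernel c)) := by
    unfold Function.uncurry logEllipticKernel
    fun_prop
  rw [integrable_prod_iff' hmeas.aestronglyMeasurable]
  constructor
  · filter_upwards [ae_restrict_mem measurableSet_Ioo] with z hz
    exact (integral_logEllipticKernel_left hc hz).1
  · have h := (integrableOn_ellipticK_integrand (sqrt_one_sub_sq_mem_Ioo hc)).const_mul
      (Real.pi / 2)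
    rw [Real.sq_sqrt (sub_pos.2 (sq_mem_Ioo_zero_one hc).2).le] at h
    refine IntegrableOn.congr_fun h (fun z hz => ?_) measurableSet_Ioo
    rw [← (integral_logEllipticKernel_left hc hz).2]
    refine setIntegral_congr_fun measurableSet_Ioo fun x hx => ?_
    exact (Real.norm_of_nonneg (logEllipticKernel_nonneg hc hx hz)).symm

theorem integral_two_log_add_log_div_sqrt {c : ℝ} (hc : c ∈ Ioo (0 : ℝ) 1) :
    IntegrableOn (fun x : ℝ => -(2 * Real.log x + Real.log c) /
        Real.sqrt ((1 - x ^ 2) * (1 - c ^ 2 * x ^ 2))) (Ioo 0 1) ∧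
      ∫ x in Ioo (0 : ℝ) 1, -(2 * Real.log x + Real.log c) /
        Real.sqrt ((1 - x ^ 2) * (1 - c ^ 2 * x ^ 2)) =
        Real.pi / 2 * ellipticK (Real.sqrt (1 - c ^ 2)) := by
  have hint := integrable_logEllipticKernel hc
  constructor
  · refine IntegrableOn.congr_fun hint.integral_prod_left (fun x hx => ?_) measurableSet_Ioo
    exact integral_logEllipticKernel_right hc hx
  · calc _ = ∫ x in Ioo (0 : ℝ) 1, ∫ z in Ioo (0 : ℝ) 1, logEllipticKernel c x z :=
          setIntegral_congr_fun measurableSet_Ioo fun x hx =>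
            (integral_logEllipticKernel_right hc hx).symm
      _ = ∫ z in Ioo (0 : ℝ) 1, ∫ x in Ioo (0 : ℝ) 1, logEllipticKernel c x z :=
          integral_integral_swap hint
      _ = ∫ z in Ioo (0 : ℝ) 1,
            Real.pi / 2 * (1 / Real.sqrt ((1 - z ^ 2) * (1 - (1 - c ^ 2) * z ^ 2))) :=
          setIntegral_congr_fun measurableSet_Ioo fun z hz =>
            (integral_logEllipticKernel_left hc hz).2
      _ = _ := by
          rw [integral_const_mul, ellipticK_eq_integral_Ioo,
            Real.sq_sqrt (sub_pos.2 (sq_mem_Ioo_zero_one hc).2).le]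

theorem intervalIntegrable_integrandJ_and_integral {c : ℝ} (hc : c ∈ Ioo (0 : ℝ) 1) :
    IntervalIntegrable (integrandJ c) volume 0 1 ∧
      ∫ x in (0 : ℝ)..1, integrandJ c x =
        -(Real.pi / 4) * ellipticK (Real.sqrt (1 - c ^ 2)) - 1 / 2 * ellipticK c * Real.log c := by
  obtain ⟨hi, he⟩ := integral_two_log_add_log_div_sqrt hc
  have hK := integrableOn_ellipticK_integrand hc
  have hJ : integrandJ c = fun x => -(1 / 2) * (-(2 * Real.log x + Real.log c) /
      Real.sqrt ((1 - x ^ 2) * (1 - c ^ 2 * x ^ 2))) -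
      1 / 2 * Real.log c * (1 / Real.sqrt ((1 - x ^ 2) * (1 - c ^ 2 * x ^ 2))) := by
    funext x
    unfold integrandJ
    ring
  rw [intervalIntegrable_iff_integrableOn_Ioo_of_le zero_le_one,
    intervalIntegral.integral_of_le zero_le_one, integral_Ioc_eq_integral_Ioo, hJ]
  refine ⟨(hi.const_mul _).sub (hK.const_mul _), ?_⟩
  rw [integral_sub (hi.const_mul _) (hK.const_mul _), integral_const_mul, integral_const_mul, he,
    ← ellipticK_eq_integral_Ioo]
  ring

theorem integrandI_eq {a b : ℝ} (ha : 0 < a) (hb : 0 < b) {t : ℝ} (ht : 0 < t) :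
    integrandI a b (b * t) = 1 / (a * b) * (integrandJ (b / a) t +
      Real.log b * (1 / Real.sqrt ((1 - t ^ 2) * (1 - (b / a) ^ 2 * t ^ 2)))) := by
  have e : (a ^ 2 - (b * t) ^ 2) * (b ^ 2 - (b * t) ^ 2) =
      (a * b) ^ 2 * ((1 - t ^ 2) * (1 - (b / a) ^ 2 * t ^ 2)) := by
    field_simp
  unfold integrandI integrandJ
  rw [e, Real.sqrt_mul (by positivity), Real.sqrt_sq (by positivity),
    Real.log_mul hb.ne' ht.ne']
  rw [← div_div]
  ring

theorem intervalIntegrable_integrandI_and_integral {a b : ℝ} (hb : 0 < b) (hab : b < a) :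
    IntervalIntegrable (integrandI a b) volume 0 b ∧
      ∫ x in (0 : ℝ)..b, integrandI a b x =
        1 / (2 * a) * (ellipticK (b / a) * Real.log (a * b)
          - Real.pi / 2 * ellipticK (Real.sqrt (a ^ 2 - b ^ 2) / a)) := by
  have ha : 0 < a := hb.trans hab
  have hc : b / a ∈ Ioo (0 : ℝ) 1 := ⟨div_pos hb ha, (div_lt_one ha).2 hab⟩
  obtain ⟨hi, he⟩ := intervalIntegrable_integrandJ_and_integral hc
  have hK := (intervalIntegrable_iff_integrableOn_Ioo_of_le zero_le_one).2
    (integrableOn_ellipticK_integrand hc)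
  have hsum := (hi.add (hK.const_mul (Real.log b))).const_mul (1 / (a * b))
  have hEq : EqOn (fun t => 1 / (a * b) * (integrandJ (b / a) t +
      Real.log b * (1 / Real.sqrt ((1 - t ^ 2) * (1 - (b / a) ^ 2 * t ^ 2)))))
      (fun t => integrandI a b (b * t)) (uIoc 0 1) := fun t ht => by
    rw [uIoc_of_le zero_le_one] at ht
    exact (integrandI_eq ha hb ht.1).symm
  constructor
  · have h := hsum.congr hEq
    -- Scaling by `b⁻¹` undoes `x = b t` and carries `[0, 1]` to `[0, b]`.
    have h2 := h.comp_mul_left (c := b⁻¹)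
    simpa [hb.ne'] using h2
  · have h := intervalIntegral.integral_comp_mul_left (a := 0) (b := 1) (integrandI a b) hb.ne'
    rw [mul_zero, mul_one, smul_eq_mul, eq_inv_mul_iff_mul_eq₀ hb.ne'] at h
    have hcongr : ∫ t in (0 : ℝ)..1, integrandI a b (b * t) = _ :=
      intervalIntegral.integral_congr_ae (ae_of_all _ fun t ht => (hEq ht).symm)
    have hs : Real.sqrt (a ^ 2 - b ^ 2) / a = Real.sqrt (1 - (b / a) ^ 2) := by
      rw [show 1 - (b / a) ^ 2 = (a ^ 2 - b ^ 2) / a ^ 2 by field_simp,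
        Real.sqrt_div' _ (by positivity), Real.sqrt_sq ha.le]
    rw [← h, hcongr, intervalIntegral.integral_const_mul,
      intervalIntegral.integral_add hi (hK.const_mul _), intervalIntegral.integral_const_mul, he,
      hs, Real.log_mul ha.ne' hb.ne', Real.log_div hb.ne' ha.ne']
    change b * (1 / (a * b) * (_ + Real.log b * ellipticK (b / a))) = _
    field_simp
    ring

theorem mainTheorem1 :
    (∀ a b : ℝ, 0 < b → b < a →
      IntervalIntegrable (integrandI a b) MeasureTheory.volume 0 b ∧
      ∫ x in (0 : ℝ)..b, integrandI a b x =
        1 / (2 * a) * (ellipticK (b / a) * Real.log (a * b)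
          - Real.pi / 2 * ellipticK (Real.sqrt (a ^ 2 - b ^ 2) / a))) ∧
    (∀ c : ℝ, 0 < c → c < 1 →
      IntervalIntegrable (integrandJ c) MeasureTheory.volume 0 1 ∧
      ∫ x in (0 : ℝ)..1, integrandJ c x =
        -(Real.pi / 4) * ellipticK (Real.sqrt (1 - c ^ 2))
          - 1 / 2 * ellipticK c * Real.log c) :=
  ⟨fun _ _ hb hab => intervalIntegrable_integrandI_and_integral hb hab,
    fun _ h0 h1 => intervalIntegrable_integrandJ_and_integral ⟨h0, h1⟩⟩
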